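/- Let $d\ge 0$, let $\|\cdot\|$ be an arbitrary norm on $\mathbb{R}^d$, and let $X\subset\mathbb{R}^d$ be a finite set. For a finite non-empty set $C$ put $\operatorname{diam}(C)=\max_{x,y\in C}\|x-y\|$. For $1\le k\le|X|$, a $k$-clustering of $X$ is a partition of $X$ into $k$ non-empty sets (clusters); its diameter cost is the largest diameter of one of its clusters, and $\mathrm{opt}_k$ denotes the minimum diameter cost over all $k$-clusterings of $X$. Agglomerative complete linkage starts with the clustering $\mathcal{C}_{|X|}=\{\{x\}\mid x\in X\}$ and, for $i=|X|-1,\dots,1$, obtains $\mathcal{C}_i$ from $\mathcal{C}_{i+1}$ by replacing two distinct clusters $A,B\in\mathcal{C}_{i+1}$ that minimise $\operatorname{diam}(A\cup B)$ by their union $A\cup B$, ties being broken arbitrarily. Then for every run of this algorithm on $X$ and every integer $k$ with $1\le k\le|X|$, $$\operatorname{cost}_{\operatorname{diam}}(\mathcal{C}_k)\ \le\ 2(\log_2 k+2)\left(2^{3\sigma}(28d+6)+2\right)\cdot\mathrm{opt}_k,\qquad \sigma=(42d)^d .$$ In particular the approximation factor is $O(\log k)$ with a constant that is at most doubly exponential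 in the dimension: there is a function $c:\mathbb{N}\to\mathbb{R}$ with $c(d)\le 2^{2^{O(d\log (d+1))}}$ for $d\ge1$, depending on nothing but $d$, such that $\operatorname{cost}_{\operatorname{diam}}(\mathcal{C}_k)\le c(d)\cdot\log_2 k\cdot\mathrm{opt}_k$ for all $2\le k\le|X|$. -/

import Mathlib

/-- The diameter cost of a clustering `P` of the finite set `X` (a partition of `X` into non-empty
clusters): the largest diameter of a cluster. The diameter is taken in the metric `‖x - y‖`. -/
noncomputable def diamCost {E : Type*} [NormedAddCommGroup E] [DecidableEq E] {X : Finset E}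
    (P : Finpartition X) : ℝ :=
  ⨆ A : {A : Finset E // A ∈ P.parts}, Metric.diam ((A : Finset E) : Set E)

/-- The cost of an optimal diameter `k`-clustering of `X`: the least diameter cost of a partition
of `X` into `k` non-empty clusters. For `1 ≤ k ≤ |X|` this is the minimum of a non-empty finite set
of non-negative reals. -/
noncomputable def optDiamCost {E : Type*} [NormedAddCommGroup E] [DecidableEq E]
    (X : Finset E) (k : ℕ) : ℝ :=
  sInf {c : ℝ | ∃ P : Finpartition X, P.parts.card = k ∧ diamCost P = c}

/-- One step of agglomerative complete linkage: `Q` arises from `P` by merging two distinct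
clusters `A`, `B` of `P` for which the diameter of `A ∪ B` is minimal among all pairs of distinct
clusters of `P`. Ties may be broken arbitrarily. -/
def IsCompleteLinkageStep {E : Type*} [NormedAddCommGroup E] [DecidableEq E] {X : Finset E}
    (P Q : Finpartition X) : Prop :=
  ∃ A ∈ P.parts, ∃ B ∈ P.parts, A ≠ B ∧
    (∀ A' ∈ P.parts, ∀ B' ∈ P.parts, A' ≠ B' →
      Metric.diam ((A ∪ B : Finset E) : Set E) ≤ Metric.diam ((A' ∪ B' : Finset E) : Set E)) ∧
    Q.parts = insert (A ∪ B) ((P.parts.erase A).erase B)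

/-- `C` is the output of a run of agglomerative complete linkage on the input `X`: the clustering
`C |X|` consists of the singletons (this is the least element `⊥` of the partitions of `X`), and for
`i = |X| - 1, …, 1` the clustering `C i` arises from `C (i + 1)` by a merge step. The values `C i`
with `i = 0` or `i > |X|` are irrelevant. -/
def IsCompleteLinkageRun {E : Type*} [NormedAddCommGroup E] [DecidableEq E] (X : Finset E)
    (C : ℕ → Finpartition X) : Prop :=
  C X.card = ⊥ ∧ ∀ i : ℕ, 1 ≤ i → i < X.card → IsCompleteLinkageStep (C (i + 1)) (C i)

/-- `c` grows at most doubly exponentially in the dimension: `c d ≤ 2 ^ 2 ^ O(d log d)`.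
(The logarithm is taken of `d + 1` so that it does not vanish at `d = 1`.) -/
def IsAtMostDoublyExponential (c : ℕ → ℝ) : Prop :=
  ∃ a : ℝ, ∀ d : ℕ, 1 ≤ d →
    c d ≤ (2 : ℝ) ^ ((2 : ℝ) ^ (a * (d : ℝ) * Real.logb 2 ((d : ℝ) + 1)))

open Metric

/-! ### Counting clusters under coarsening -/

section Finpartition

variable {α : Type*} [DecidableEq α] {X : Finset α}

/-! The factor obtained is `8 * 2 ^ (3 * (42 * d) ^ d)`, free of `k`; both stated bounds follow from
it. Let `L t` be the last clustering of cost at most `t`, and let `P` be a `k`-clustering with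
diameters at most `r`. If `L (M * r)` has at most `k` clusters, it coarsens `C k`, so `C k` costs at
most `M * r`.

When the threshold grows, every new cluster contains two old ones, so twice the new count is at most
the old count plus the number of persistent clusters. Persistent clusters are few, since two of them
lying close together would have a union of small diameter. Three bounds on them are used, the first
two inside unions of subfamilies `V` of `P`.

Below `r`, a net and volume packing bound them; summing over geometric scales gives `K * |V|`
clusters at `r` (`card_partsWithin_le`). Above `r`, each set of `V` meets at most one, so the excess
over `|V|` halves at each doubling until at most `3 / 2 * |V|` clusters remain
(`two_pow_mul_card_partsWithin_le`). Finally, one more enlargement removes the factor `3 / 2`: a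
persistent cluster not confined to an isolated part of `P` uses up two parts (`card_parts_le`). -/

/-- The clusters of `P` that are contained in `W`. -/
def Finpartition.partsWithin (P : Finpartition X) (W : Finset α) : Finset (Finset α) :=
  P.parts.filter (· ⊆ W)

lemma Finpartition.mem_partsWithin {P : Finpartition X} {W A : Finset α} :
    A ∈ P.partsWithin W ↔ A ∈ P.parts ∧ A ⊆ W := Finset.mem_filter

lemma Finpartition.part_subset_of_le {P Q : Finpartition X} (h : P ≤ Q) {A : Finset α}
    (hA : A ∈ Q.parts) {a : α} (ha : a ∈ A) : P.part a ⊆ A := by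
  have haX : a ∈ X := Q.subset hA ha
  obtain ⟨A', hA', hle⟩ := h (P.part_mem.2 haX)
  have : A' = A := Q.eq_of_mem_parts hA' hA (hle (P.mem_part_self.2 haX)) ha
  exact this ▸ hle

/-- The indicator pays for the only case in which `A` contains a single cluster of `P`, namely `A`
itself. -/
lemma Finpartition.two_le_card_partsWithin_add {P Q : Finpartition X} (h : P ≤ Q) {A : Finset α}
    (hA : A ∈ Q.parts) :
    2 ≤ (P.partsWithin A).card + if A ∈ P.parts then 1 else 0 := by
  obtain ⟨a, ha⟩ := Q.nonempty_of_mem_parts hA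
  have hp : ∀ a ∈ A, P.part a ∈ P.partsWithin A := fun a ha =>
    mem_partsWithin.2 ⟨P.part_mem.2 (Q.subset hA ha), part_subset_of_le h hA ha⟩
  split_ifs with hAP
  · have := Finset.card_pos.2 ⟨_, hp a ha⟩
    omega
  · have hne : P.part a ≠ A := fun he => hAP (he ▸ (mem_partsWithin.1 (hp a ha)).1)
    obtain ⟨b, hb, hba⟩ := Finset.exists_of_ssubset
      (Finset.ssubset_iff_subset_ne.2 ⟨(mem_partsWithin.1 (hp a ha)).2, hne⟩)
    have : P.part b ≠ P.part a := fun he =>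
      hba (he ▸ P.mem_part_self.2 (Q.subset hA hb))
    exact Finset.one_lt_card.2 ⟨_, hp b hb, _, hp a ha, this⟩

/-- A cluster of a coarser partition which is not a cluster of the finer partition contains at
least two clusters of the latter. -/
lemma Finpartition.two_mul_card_partsWithin_le {P Q : Finpartition X} (h : P ≤ Q) (W : Finset α) :
    2 * (Q.partsWithin W).card ≤
      (P.partsWithin W).card + ((Q.partsWithin W).filter (· ∈ P.parts)).card := by
  have hdisj : (Q.partsWithin W : Set (Finset α)).PairwiseDisjoint P.partsWithin := by
    intro A hA B hB hAB
    refine Finset.disjoint_left.2 fun S hSA hSB => hAB ?_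
    obtain ⟨a, ha⟩ := P.nonempty_of_mem_parts (mem_partsWithin.1 hSA).1
    exact Q.eq_of_mem_parts (mem_partsWithin.1 hA).1 (mem_partsWithin.1 hB).1
      ((mem_partsWithin.1 hSA).2 ha) ((mem_partsWithin.1 hSB).2 ha)
  calc 2 * (Q.partsWithin W).card
      = ∑ A ∈ Q.partsWithin W, 2 := by rw [Finset.sum_const, smul_eq_mul, mul_comm]
    _ ≤ ∑ A ∈ Q.partsWithin W, ((P.partsWithin A).card + if A ∈ P.parts then 1 else 0) :=
        Finset.sum_le_sum fun A hA => two_le_card_partsWithin_add h (mem_partsWithin.1 hA).1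
    _ = ((Q.partsWithin W).biUnion P.partsWithin).card +
          ((Q.partsWithin W).filter (· ∈ P.parts)).card := by
        rw [Finset.sum_add_distrib, Finset.card_biUnion hdisj, Finset.card_filter]
    _ ≤ _ := by
        gcongr
        refine Finset.biUnion_subset.2 fun A hA S hS => ?_
        rw [mem_partsWithin] at *
        exact ⟨hS.1, hS.2.trans hA.2⟩

lemma Finpartition.partsWithin_self (P : Finpartition X) : P.partsWithin X = P.parts :=
  Finset.filter_true_of_mem fun _ h => P.subset h

end Finpartition

/-! ### Volume packing -/

/-- The volume bound on packings: a finite `ρ`-separated set inside a ball of radius `R`. -/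
lemma card_le_of_separated_of_dist_le {E : Type*} [NormedAddCommGroup E] [NormedSpace ℝ E]
    [FiniteDimensional ℝ E] {ρ R : ℝ} (hρ : 0 < ρ) (hR : 0 ≤ R) (c : E) (s : Finset E)
    (hs : ∀ x ∈ s, dist x c ≤ R) (h : ∀ x ∈ s, ∀ y ∈ s, x ≠ y → ρ ≤ dist x y) :
    (s.card : ℝ) ≤ (2 * R / ρ + 1) ^ Module.finrank ℝ E := by
  borelize E
  let μ : MeasureTheory.Measure E := MeasureTheory.Measure.addHaar
  have hδ : 0 < ρ / 2 := by positivity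
  have hR' : 0 < R + ρ / 2 := by positivity
  have D : Set.PairwiseDisjoint (s : Set E) fun x => ball x (ρ / 2) := by
    intro x hx y hy hxy
    refine ball_disjoint_ball ?_
    linarith [h x hx y hy hxy]
  have hsub : (⋃ x ∈ s, ball x (ρ / 2)) ⊆ ball c (R + ρ / 2) := by
    refine Set.iUnion₂_subset fun x hx => ball_subset_ball' ?_
    linarith [hs x hx]
  have I' : (s.card : ENNReal) * ENNReal.ofReal ((ρ / 2) ^ Module.finrank ℝ E) * μ (ball 0 1) ≤
      ENNReal.ofReal ((R + ρ / 2) ^ Module.finrank ℝ E) * μ (ball 0 1) := by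
    have I := MeasureTheory.measure_mono (μ := μ) hsub
    rw [MeasureTheory.measure_biUnion_finset D fun x _ => measurableSet_ball] at I
    simp only [μ.addHaar_ball_of_pos _ hδ, μ.addHaar_ball_of_pos _ hR', Finset.sum_const,
      nsmul_eq_mul, ← mul_assoc] at I
    exact I
  have J := (ENNReal.mul_le_mul_iff_left (measure_ball_pos μ _ zero_lt_one).ne'
    MeasureTheory.measure_ball_lt_top.ne).1 I'
  have K := ENNReal.toReal_le_of_le_ofReal (by positivity) J
  rw [ENNReal.toReal_mul, ENNReal.toReal_natCast, ENNReal.toReal_ofReal (by positivity)] at K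
  have e : (2 * R / ρ + 1) = (R + ρ / 2) / (ρ / 2) := by field_simp
  rw [e, div_pow, le_div_iff₀ (by positivity)]
  exact K

/-! ### Linkage filtrations and thresholds above `r` -/

section Diam

variable {E : Type*} [NormedAddCommGroup E] [DecidableEq E] {X : Finset E}

omit [DecidableEq E] in
lemma Finset.dist_le_diam (A : Finset E) {x y : E} (hx : x ∈ A) (hy : y ∈ A) :
    dist x y ≤ diam (A : Set E) :=
  dist_le_diam_of_mem A.finite_toSet.isBounded hx hy

lemma Finset.diam_union_le (A B : Finset E) {a b : E} (ha : a ∈ A) (hb : b ∈ B) :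
    diam ((A ∪ B : Finset E) : Set E) ≤ diam (A : Set E) + dist a b + diam (B : Set E) := by
  rw [Finset.coe_union]
  exact diam_union (Finset.mem_coe.2 ha) (Finset.mem_coe.2 hb)

/-- A partition of `X` for every non-negative threshold `t`: the clusters have diameter at most
`t`, the union of any two of them has diameter greater than `t`, and the partitions get coarser as
the threshold grows. -/
structure IsLinkageFiltration (L : ℝ → Finpartition X) : Prop where
  diam_le : ∀ {t : ℝ}, 0 ≤ t → ∀ {A}, A ∈ (L t).parts → diam (A : Set E) ≤ t
  lt_diam_union : ∀ {t : ℝ}, 0 ≤ t → ∀ {A B}, A ∈ (L t).parts → B ∈ (L t).parts → A ≠ B →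
    t < diam ((A ∪ B : Finset E) : Set E)
  mono : ∀ {s t : ℝ}, 0 ≤ s → s ≤ t → L s ≤ L t

variable {L : ℝ → Finpartition X} {P : Finpartition X} {r : ℝ}

/-- If the sets in `V` have diameter at most `r`, then each of them meets at most one cluster
which persists from the threshold `s` to the threshold `2 * s + r`. -/
lemma IsLinkageFiltration.card_persistent_le (hL : IsLinkageFiltration L)
    {V : Finset (Finset E)} (hP : ∀ O ∈ V, diam (O : Set E) ≤ r) {s t : ℝ} (hs : 0 ≤ s)
    (ht : 0 ≤ t) (hst : 2 * s + r ≤ t) :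
    (((L t).partsWithin (V.biUnion id)).filter (· ∈ (L s).parts)).card ≤ V.card := by
  have hex : ∀ A ∈ ((L t).partsWithin (V.biUnion id)).filter (· ∈ (L s).parts),
      ∃ O ∈ V, ∃ x ∈ A, x ∈ O := by
    intro A hA
    rw [Finset.mem_filter, Finpartition.mem_partsWithin] at hA
    obtain ⟨x, hx⟩ := (L t).nonempty_of_mem_parts hA.1.1
    obtain ⟨O, hO, hxO⟩ := Finset.mem_biUnion.1 (hA.1.2 hx)
    exact ⟨O, hO, x, hx, hxO⟩
  choose! f hfV g hgA hgf using hex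
  -- Two persistent clusters meeting the same `O` would have a union of diameter at most `s + r + s
  -- ≤ t`.
  refine Finset.card_le_card_of_injOn f (fun A hA => hfV A hA) fun A hA B hB hAB => ?_
  by_contra hne
  have hgA' := hgf A hA
  have hgB' := hgf B hB
  rw [hAB] at hgA'
  have h1 := Finset.dist_le_diam _ hgA' hgB'
  have h2 := hP _ (hfV B hB)
  have h3 := Finset.diam_union_le A B (hgA A hA) (hgA B hB)
  have hA' := hA
  have hB' := hB
  rw [Finset.mem_coe, Finset.mem_filter, Finpartition.mem_partsWithin] at hA' hB'
  have h4 := hL.lt_diam_union ht hA'.1.1 hB'.1.1 hne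
  linarith [hL.diam_le hs hA'.2, hL.diam_le hs hB'.2]

/-- Every doubling of the threshold halves the number of clusters exceeding `V.card`. -/
lemma IsLinkageFiltration.two_pow_mul_card_partsWithin_le (hL : IsLinkageFiltration L)
    {V : Finset (Finset E)} (hr : 0 ≤ r) (hP : ∀ O ∈ V, diam (O : Set E) ≤ r) (j : ℕ) :
    (2 : ℝ) ^ j * (((L (2 ^ j * (2 * r) - r)).partsWithin (V.biUnion id)).card - V.card) ≤
      ((L r).partsWithin (V.biUnion id)).card - V.card := by
  -- The threshold iterates `s ↦ 2 * s + r` from `r`, so threshold plus `r` doubles each time.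
  induction j with
  | zero => simp [two_mul]
  | succ j ih =>
    have hj : (1 : ℝ) ≤ 2 ^ j := one_le_pow₀ (by norm_num)
    have h0 : 0 ≤ 2 ^ j * (2 * r) - r := by nlinarith
    have h1 : 2 ^ j * (2 * r) - r ≤ 2 ^ (j + 1) * (2 * r) - r := by rw [pow_succ]; nlinarith
    have h2 := Finpartition.two_mul_card_partsWithin_le (hL.mono h0 h1) (V.biUnion id)
    have h3 := hL.card_persistent_le hP h0 (h0.trans h1) (by rw [pow_succ]; linarith)
    refine le_trans ?_ ih
    rw [show ∀ x : ℝ, (2 : ℝ) ^ (j + 1) * x = 2 ^ j * (2 * x) by intro x; ring]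
    refine mul_le_mul_of_nonneg_left ?_ (by positivity)
    have h4 := h2.trans (Nat.add_le_add_left h3 _)
    have : (2 : ℝ) * ((L (2 ^ (j + 1) * (2 * r) - r)).partsWithin (V.biUnion id)).card ≤
      ((L (2 ^ j * (2 * r) - r)).partsWithin (V.biUnion id)).card + V.card := mod_cast h4
    linarith

/-- The maximal `ρ`-separated subsets of a finite set are `ρ`-nets. -/
lemma Finset.exists_separated_net {ρ : ℝ} (hρ : 0 < ρ) (W : Finset E) :
    ∃ N ⊆ W, (∀ x ∈ N, ∀ y ∈ N, x ≠ y → ρ ≤ dist x y) ∧ ∀ x ∈ W, ∃ y ∈ N, dist x y < ρ := by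
  classical
  obtain ⟨N, hN, hmax⟩ := Finset.exists_max_image
    (W.powerset.filter fun N => ∀ x ∈ N, ∀ y ∈ N, x ≠ y → ρ ≤ dist x y) Finset.card
    ⟨∅, by simp⟩
  rw [Finset.mem_filter, Finset.mem_powerset] at hN
  refine ⟨N, hN.1, hN.2, fun x hx => ?_⟩
  by_contra! hcon
  have hxN : x ∉ N := fun h => by
    have := hcon x h
    rw [dist_self] at this
    linarith
  have := hmax (insert x N) (Finset.mem_filter.2 ⟨Finset.mem_powerset.2
    (Finset.insert_subset hx hN.1), ?_⟩)
  · rw [Finset.card_insert_of_notMem hxN] at this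
    omega
  · intro y hy z hz hyz
    rw [Finset.mem_insert] at hy hz
    rcases hy with rfl | hy <;> rcases hz with rfl | hz
    · exact absurd rfl hyz
    · exact hcon z hz
    · rw [dist_comm]; exact hcon y hy
    · exact hN.2 y hy z hz hyz

end Diam

/-! ### Thresholds below `r`: footprints in a net -/

section Footprint

variable {E : Type*} [NormedAddCommGroup E] [DecidableEq E] {X : Finset E}
  {L : ℝ → Finpartition X} {r : ℝ}

/-- Clusters persisting from the threshold `s` to the threshold `s + 2 * ρ` are determined by the
sets of their nearest points in a `ρ`-net. -/
lemma IsLinkageFiltration.card_persistent_le_of_net (hL : IsLinkageFiltration L) {W N : Finset E}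
    {ρ s : ℝ} {F : ℕ} (hρ : 0 < ρ) (hs : 0 ≤ s) (hnet : ∀ x ∈ W, ∃ y ∈ N, dist x y < ρ)
    (hF : ∀ p ∈ N, (N.filter (dist · p ≤ s + 2 * ρ)).card ≤ F) :
    (((L (s + 2 * ρ)).partsWithin W).filter (· ∈ (L s).parts)).card ≤ N.card * 2 ^ F := by
  choose! f hfN hf using hnet
  have hsub : ∀ A ∈ ((L (s + 2 * ρ)).partsWithin W).filter (· ∈ (L s).parts),
      A ∈ (L (s + 2 * ρ)).parts ∧ A ⊆ W ∧ A ∈ (L s).parts := by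
    intro A hA
    rwa [Finset.mem_filter, Finpartition.mem_partsWithin, and_assoc] at hA
  have hdist : ∀ A ∈ (L s).parts, ∀ x ∈ A, ∀ y ∈ A, dist x y ≤ s := fun A hA x hx y hy =>
    (Finset.dist_le_diam A hx hy).trans (hL.diam_le hs hA)
  -- A footprint is encoded by one of its net points and a subset of the net points within `s + 2 *
  -- ρ` of it.
  have hmaps : Set.MapsTo (fun A : Finset E => A.image f)
      (((L (s + 2 * ρ)).partsWithin W).filter (· ∈ (L s).parts) : Finset (Finset E))
      (N.biUnion fun p => (N.filter (dist · p ≤ s + 2 * ρ)).powerset : Finset (Finset E)) := by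
    intro A hA
    obtain ⟨hAt, hAW, hAs⟩ := hsub A hA
    obtain ⟨a, ha⟩ := (L s).nonempty_of_mem_parts hAs
    rw [Finset.mem_coe, Finset.mem_biUnion]
    refine ⟨f a, hfN a (hAW ha), Finset.mem_powerset.2 fun y hy => ?_⟩
    obtain ⟨x, hx, rfl⟩ := Finset.mem_image.1 hy
    refine Finset.mem_filter.2 ⟨hfN x (hAW hx), ?_⟩
    have h1 := dist_triangle4 (f x) x a (f a)
    rw [dist_comm (f x) x] at h1
    linarith [hf x (hAW hx), hf a (hAW ha), hdist A hAs x hx a ha]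
  refine (Finset.card_le_card_of_injOn _ hmaps ?_).trans
    (Finset.card_biUnion_le_card_mul _ _ _ fun p hp => ?_)
  · intro A hA B hB hAB
    by_contra hne
    obtain ⟨hAt, hAW, hAs⟩ := hsub A hA
    obtain ⟨hBt, hBW, hBs⟩ := hsub B hB
    -- With equal footprints, some `z ∈ A` shares the net point of `y`; the path from `x` through
    -- `z` and that point to `y` has length at most `s + ρ + ρ`.
    have key : ∀ x ∈ A, ∀ y ∈ B, dist x y ≤ s + 2 * ρ := by
      intro x hx y hy
      have : f y ∈ A.image f := by
        rw [show A.image f = B.image f from hAB]; exact Finset.mem_image_of_mem f hy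
      obtain ⟨z, hz, hzy⟩ := Finset.mem_image.1 this
      have h1 := dist_triangle4 x z (f z) y
      have h2 := hf y (hBW hy)
      rw [dist_comm, ← hzy] at h2
      linarith [hf z (hAW hz), hdist A hAs x hx z hz]
    refine (hL.lt_diam_union (by positivity) hAt hBt hne).not_ge
      (diam_le_of_forall_dist_le (by positivity) fun x hx y hy => ?_)
    rw [Finset.coe_union] at hx hy
    rcases hx with hx | hx <;> rcases hy with hy | hy
    · linarith [hdist A hAs x hx y hy]
    · exact key x hx y hy
    · rw [dist_comm]; exact key y hy x hx
    · linarith [hdist B hBs x hx y hy]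
  · rw [Finset.card_powerset]
    exact Nat.pow_le_pow_right two_pos (hF p hp)

variable [NormedSpace ℝ E] [FiniteDimensional ℝ E]

/-- A separated subset of a union of sets of diameter at most `r`. -/
lemma card_le_of_separated_of_subset_biUnion {V : Finset (Finset E)} {N : Finset E} {ρ : ℝ}
    (hρ : 0 < ρ) (hr : 0 ≤ r) (hP : ∀ O ∈ V, diam (O : Set E) ≤ r) (hN : N ⊆ V.biUnion id)
    (hsep : ∀ x ∈ N, ∀ y ∈ N, x ≠ y → ρ ≤ dist x y) :
    (N.card : ℝ) ≤ V.card * (2 * r / ρ + 1) ^ Module.finrank ℝ E := by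
  have h1 : N ⊆ V.biUnion fun O => N ∩ O := by
    intro x hx
    obtain ⟨O, hO, hxO⟩ := Finset.mem_biUnion.1 (hN hx)
    exact Finset.mem_biUnion.2 ⟨O, hO, Finset.mem_inter.2 ⟨hx, hxO⟩⟩
  have h2 : (N.card : ℝ) ≤ ∑ O ∈ V, ((N ∩ O).card : ℝ) :=
    mod_cast (Finset.card_le_card h1).trans Finset.card_biUnion_le
  refine h2.trans ((Finset.sum_le_card_nsmul _ _ _ fun O hO => ?_).trans_eq (nsmul_eq_mul _ _))
  rcases (N ∩ O).eq_empty_or_nonempty with h | ⟨c, hc⟩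
  · rw [h, Finset.card_empty, Nat.cast_zero]
    positivity
  · refine card_le_of_separated_of_dist_le hρ hr c _ (fun x hx => ?_) fun x hx y hy =>
      hsep x (Finset.mem_inter.1 hx).1 y (Finset.mem_inter.1 hy).1
    exact (Finset.dist_le_diam O (Finset.mem_inter.1 hx).2 (Finset.mem_inter.1 hc).2).trans
      (hP O hO)

variable {d : ℕ}

/-- The net has mesh `ρ = s / (4 * d)`, so the threshold grows by `2 * ρ`, a factor `1 + 1 / (2 *
d)`. Packing radius `s + 2 * ρ` at separation `ρ` gives `8 * d + 5`; the size of the net gives `(9 *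
d * (r / s)) ^ d`. -/
lemma IsLinkageFiltration.two_mul_card_partsWithin_le (hL : IsLinkageFiltration L)
    (hd : Module.finrank ℝ E = d) (hd1 : 1 ≤ d) {V : Finset (Finset E)}
    (hP : ∀ O ∈ V, diam (O : Set E) ≤ r) {s : ℝ} (hs : 0 < s) (hsr : s ≤ r) :
    (2 : ℝ) * ((L (s * (1 + 1 / (2 * d)))).partsWithin (V.biUnion id)).card ≤
      ((L s).partsWithin (V.biUnion id)).card +
        V.card * 2 ^ ((8 * d + 5) ^ d) * (9 * d * (r / s)) ^ d := by
  have hd0 : (1 : ℝ) ≤ d := mod_cast hd1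
  have hρ : 0 < s / (4 * d) := by positivity
  obtain ⟨N, hNW, hsep, hnet⟩ := Finset.exists_separated_net hρ (V.biUnion id)
  have ht : s * (1 + 1 / (2 * d)) = s + 2 * (s / (4 * d)) := by field_simp; ring
  have hF : ∀ p ∈ N, (N.filter (dist · p ≤ s + 2 * (s / (4 * d)))).card ≤ (8 * d + 5) ^ d := by
    intro p hp
    have := card_le_of_separated_of_dist_le (R := s + 2 * (s / (4 * d))) hρ (by positivity) p
      (N.filter (dist · p ≤ s + 2 * (s / (4 * d)))) (fun x hx => (Finset.mem_filter.1 hx).2)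
      fun x hx y hy => hsep x (Finset.mem_filter.1 hx).1 y (Finset.mem_filter.1 hy).1
    rw [hd, show 2 * (s + 2 * (s / (4 * d))) / (s / (4 * d)) + 1 = 8 * (d : ℝ) + 5 by
      field_simp; ring] at this
    exact mod_cast this
  have h1 := Finpartition.two_mul_card_partsWithin_le
    (hL.mono hs.le (show s ≤ s + 2 * (s / (4 * d)) by linarith)) (V.biUnion id)
  have h2 := h1.trans (Nat.add_le_add_left
    (hL.card_persistent_le_of_net hρ hs.le hnet hF) _)
  have h3 := card_le_of_separated_of_subset_biUnion hρ (hs.le.trans hsr) hP hNW hsep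
  have h4 : 2 * r / (s / (4 * d)) + 1 ≤ 9 * d * (r / s) := by
    have h5 : 1 ≤ r / s := (one_le_div hs).2 hsr
    have h6 : 2 * r / (s / (4 * d)) = 8 * d * (r / s) := by field_simp; ring
    rw [h6]
    nlinarith
  have h7 : (N.card : ℝ) ≤ V.card * (9 * d * (r / s)) ^ d := by
    refine h3.trans (mul_le_mul_of_nonneg_left ?_ (by positivity))
    rw [hd]
    have : 0 ≤ r := hs.le.trans hsr
    exact pow_le_pow_left₀ (by positivity) h4 _
  rw [ht]
  have h8 : (2 : ℝ) * ((L (s + 2 * (s / (4 * d)))).partsWithin (V.biUnion id)).card ≤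
      ((L s).partsWithin (V.biUnion id)).card + N.card * 2 ^ ((8 * d + 5) ^ d) := mod_cast h2
  refine h8.trans (add_le_add_right ?_ _)
  rw [mul_right_comm]
  exact mul_le_mul_of_nonneg_right h7 (by positivity)

/-- What matters is a bound below `2`: the error term grows by this factor per scale, while the
weights halve. It holds because the power is at most `exp (1 / 2)`. -/
lemma one_add_one_div_pow_le (hd1 : 1 ≤ d) : (1 + 1 / (2 * (d : ℝ))) ^ d ≤ 5 / 3 := by
  have hd0 : (1 : ℝ) ≤ d := mod_cast hd1
  have h1 : (1 + 1 / (2 * (d : ℝ))) ^ d ≤ Real.exp (1 / 2) := by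
    calc (1 + 1 / (2 * (d : ℝ))) ^ d ≤ Real.exp (1 / (2 * (d : ℝ))) ^ d := by
          refine pow_le_pow_left₀ (by positivity) ?_ _
          rw [add_comm]
          exact Real.add_one_le_exp _
      _ = Real.exp (1 / 2) := by
          rw [← Real.exp_nat_mul]
          congr 1
          field_simp
  refine h1.trans ((sq_le_sq₀ (Real.exp_pos _).le (by norm_num)).1 ?_)
  rw [← Real.exp_nat_mul]
  norm_num
  linarith [Real.exp_one_lt_d9]

/-- At the threshold `r`, the number of clusters inside a union of sets of diameter at most `r`
is at most a constant times the number of these sets. -/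
lemma IsLinkageFiltration.card_partsWithin_le (hL : IsLinkageFiltration L)
    (hd : Module.finrank ℝ E = d) (hd1 : 1 ≤ d) (hr : 0 < r) {V : Finset (Finset E)}
    (hP : ∀ O ∈ V, diam (O : Set E) ≤ r) :
    (((L r).partsWithin (V.biUnion id)).card : ℝ) ≤
      6 * 2 ^ ((8 * d + 5) ^ d) * (9 * d) ^ d * V.card := by
  have hd0 : (1 : ℝ) ≤ d := mod_cast hd1
  set b : ℝ := 1 + 1 / (2 * d) with hb
  set G : ℝ := V.card * 2 ^ ((8 * d + 5) ^ d) * (9 * d) ^ d with hG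
  have hb1 : 1 ≤ b := by rw [hb]; linarith [show 0 ≤ 1 / (2 * (d : ℝ)) by positivity]
  have hb0 : 0 < b := by linarith
  have hbd : b ^ d ≤ 5 / 3 := one_add_one_div_pow_le hd1
  -- Unrolling the recursion over the scales `r / b ^ i` gives errors `G * (5 / 6) ^ i` for `i ≥ 1`,
  -- whose infinite sum is `5 * G`.
  have hind : ∀ i : ℕ, (((L r).partsWithin (V.biUnion id)).card : ℝ) ≤
      (1 / 2) ^ i * ((L (r / b ^ i)).partsWithin (V.biUnion id)).card +
        5 * G * (1 - (5 / 6) ^ i) := by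
    intro i
    induction i with
    | zero => simp
    | succ i ih =>
      have h := hL.two_mul_card_partsWithin_le hd hd1 hP (s := r / b ^ (i + 1)) (by positivity)
        (div_le_self hr.le (one_le_pow₀ hb1))
      have e1 : r / b ^ (i + 1) * b = r / b ^ i := by rw [pow_succ]; field_simp
      have e2 : r / (r / b ^ (i + 1)) = b ^ (i + 1) := by field_simp
      rw [← hb, e1, e2, mul_pow, ← pow_mul, mul_comm (i + 1) d, pow_mul, ← mul_assoc, ← hG] at h
      have h' : G * (b ^ d) ^ (i + 1) ≤ G * (5 / 3) ^ (i + 1) :=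
        mul_le_mul_of_nonneg_left (pow_le_pow_left₀ (by positivity) hbd _) (by positivity)
      have h2 := mul_le_mul_of_nonneg_left (h.trans (add_le_add_right h' _))
        (show (0 : ℝ) ≤ (1 / 2) ^ (i + 1) by positivity)
      have e3 : (1 / 2 : ℝ) ^ (i + 1) * (5 / 3) ^ (i + 1) = (5 / 6) ^ (i + 1) := by
        rw [← mul_pow]; norm_num
      have e4 : (1 / 2 : ℝ) ^ (i + 1) * 2 = (1 / 2) ^ i := by rw [pow_succ]; ring
      have e5 : (5 / 6 : ℝ) ^ (i + 1) = (5 / 6) ^ i * (5 / 6) := pow_succ _ _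
      rw [← mul_assoc, e4, mul_add, mul_left_comm _ G, e3] at h2
      rw [e5] at h2 ⊢
      linarith
  rcases V.eq_empty_or_nonempty with rfl | hV
  · have : (L r).partsWithin ((∅ : Finset (Finset E)).biUnion id) = ∅ := by
      refine Finset.eq_empty_of_forall_notMem fun A hA => ?_
      rw [Finpartition.mem_partsWithin] at hA
      obtain ⟨a, ha⟩ := (L r).nonempty_of_mem_parts hA.1
      simpa using hA.2 ha
    rw [this]
    simp
  · have hVc : (1 : ℝ) ≤ V.card := mod_cast hV.card_pos
    have hG1 : 1 ≤ G := by
      rw [hG]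
      refine one_le_mul_of_one_le_of_one_le (one_le_mul_of_one_le_of_one_le hVc
        (one_le_pow₀ (by norm_num))) (one_le_pow₀ (by linarith))
    -- After `X.card` scales the trivial bound `X.card ≤ 2 ^ X.card` reduces the leading term to at
    -- most `1 ≤ G`, hence `6 * G` in total.
    have h1 : (((L (r / b ^ X.card)).partsWithin (V.biUnion id)).card : ℝ) ≤ 2 ^ X.card := by
      have : ((L (r / b ^ X.card)).partsWithin (V.biUnion id)).card ≤ 2 ^ X.card :=
        (Finset.card_filter_le _ _).trans
          ((Finpartition.card_parts_le_card _).trans Nat.lt_two_pow_self.le)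
      exact mod_cast this
    have h2 := mul_le_mul_of_nonneg_left h1 (show (0 : ℝ) ≤ (1 / 2) ^ X.card by positivity)
    rw [← mul_pow] at h2
    norm_num at h2
    have h3 := hind X.card
    have h4 : 0 ≤ 5 * G * (5 / 6) ^ X.card := by positivity
    have h5 : 6 * 2 ^ ((8 * d + 5) ^ d) * (9 * (d : ℝ)) ^ d * V.card = 6 * G := by rw [hG]; ring
    rw [h5]
    norm_num at h3
    linarith

end Footprint

/-! ### From `3 / 2 * |P|` down to `|P|` -/

section Final

variable {E : Type*} [NormedAddCommGroup E] [DecidableEq E] {X : Finset E}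
  {L : ℝ → Finpartition X} {r : ℝ}

/-- If, at the threshold `s`, every union of `v` parts of `P` contains at most `3 / 2 * v` clusters,
then at the threshold `4 * s + 4 * r` there are at most as many clusters as parts of `P`. -/
lemma IsLinkageFiltration.card_parts_le (hL : IsLinkageFiltration L) {P : Finpartition X}
    (hr : 0 ≤ r) (hP : ∀ O ∈ P.parts, diam (O : Set E) ≤ r) {s : ℝ} (hs : 0 ≤ s)
    (hcount : ∀ V ⊆ P.parts, 2 * ((L s).partsWithin (V.biUnion id)).card ≤ 3 * V.card) :
    (L (4 * s + 4 * r)).parts.card ≤ P.parts.card := by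
  set t := 4 * s + 4 * r with ht
  have hst : s ≤ t := by linarith
  have ht0 : 0 ≤ t := hs.trans hst
  set S := (L t).parts.filter (· ∈ (L s).parts) with hS
  have hmain := Finpartition.two_mul_card_partsWithin_le (hL.mono hs hst) X
  rw [Finpartition.partsWithin_self, Finpartition.partsWithin_self, ← hS] at hmain
  -- parts that do not share a cluster with another part
  obtain ⟨p, hp⟩ : ∃ p : Finset E → Prop, ∀ O, p O ↔
      ∀ B ∈ (L s).parts, ∀ x ∈ B, x ∈ O → B ⊆ O := ⟨_, fun _ => Iff.rfl⟩
  have : DecidablePred p := Classical.decPred p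
  set I := P.parts.filter p with hI
  set V := P.parts.filter fun O => ¬ p O with hV
  have hIV : I.card + V.card = P.parts.card := Finset.card_filter_add_card_filter_not _
  set J := (L s).parts.filter fun B => ∃ O ∈ I, B ⊆ O with hJ
  have hJI : J.card ≤ I.card := by
    have hex : ∀ B ∈ J, ∃ O ∈ I, B ⊆ O := fun B hB => (Finset.mem_filter.1 hB).2
    choose! f hfI hf using hex
    refine Finset.card_le_card_of_injOn f (fun B hB => hfI B hB) fun A hA B hB hAB => ?_
    -- For a single part, the bound `3 / 2` rounds down to one cluster.
    have h1 := hcount {f B} (Finset.singleton_subset_iff.2 (Finset.mem_filter.1 (hfI B hB)).1)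
    rw [Finset.singleton_biUnion, Finset.card_singleton] at h1
    have h2 : ((L s).partsWithin (id (f B))).card ≤ 1 := by omega
    refine Finset.card_le_one.1 h2 A ?_ B ?_
    · exact Finpartition.mem_partsWithin.2 ⟨(Finset.mem_filter.1 hA).1, hAB ▸ hf A hA⟩
    · exact Finpartition.mem_partsWithin.2 ⟨(Finset.mem_filter.1 hB).1, hf B hB⟩
  have hout : ∀ B ∈ (L s).parts, B ∉ J → ∀ x ∈ B, ∃ O ∈ V, x ∈ O := by
    intro B hB hBJ x hx
    obtain ⟨O, hO, hxO⟩ := P.exists_mem ((L s).subset hB hx)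
    refine ⟨O, Finset.mem_filter.2 ⟨hO, fun h => hBJ ?_⟩, hxO⟩
    exact Finset.mem_filter.2 ⟨hB, O, Finset.mem_filter.2 ⟨hO, h⟩, (hp O).1 h B hB x hx hxO⟩
  -- Clusters outside `J` lie wholly in the union of `V`, where `hcount` applies.
  have hLs : 2 * (L s).parts.card ≤ 2 * I.card + 3 * V.card := by
    have h1 : (L s).parts ⊆ J ∪ (L s).partsWithin (V.biUnion id) := by
      intro B hB
      by_cases hBJ : B ∈ J
      · exact Finset.mem_union_left _ hBJ
      · refine Finset.mem_union_right _ (Finpartition.mem_partsWithin.2 ⟨hB, fun x hx => ?_⟩)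
        obtain ⟨O, hO, hxO⟩ := hout B hB hBJ x hx
        exact Finset.mem_biUnion.2 ⟨O, hO, hxO⟩
    have h2 := (Finset.card_le_card h1).trans (Finset.card_union_le _ _)
    have h3 := hcount V (Finset.filter_subset _ _)
    omega
  -- Each persistent cluster outside `J` is assigned a part of `V` that it meets and a second one
  -- linked to it by a cluster `B`; different persistent clusters receive disjoint pairs.
  have hSV : 2 * (S \ J).card ≤ V.card := by
    have hex : ∀ A ∈ S \ J, ∃ O O' : Finset E, O ∈ V ∧ O' ∈ V ∧ O ≠ O' ∧ ∃ x ∈ A, x ∈ O ∧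
        ∃ B ∈ (L s).parts, ∃ y ∈ B, ∃ z ∈ B, y ∈ O ∧ z ∈ O' := by
      intro A hA
      obtain ⟨hAS, hAJ⟩ := Finset.mem_sdiff.1 hA
      have hAs := (Finset.mem_filter.1 hAS).2
      obtain ⟨x, hx⟩ := (L s).nonempty_of_mem_parts hAs
      obtain ⟨O, hO, hxO⟩ := hout A hAs hAJ x hx
      have hO' := (Finset.mem_filter.1 hO)
      obtain ⟨hOP, hnot⟩ := hO'
      rw [hp] at hnot
      push Not at hnot
      obtain ⟨B, hB, y, hyB, hyO, hBO⟩ := hnot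
      obtain ⟨z, hzB, hzO⟩ := Finset.not_subset.1 hBO
      have hBJ : B ∉ J := by
        intro hBJ
        obtain ⟨-, O'', hO'', hBO''⟩ := Finset.mem_filter.1 hBJ
        have := P.eq_of_mem_parts (Finset.mem_filter.1 hO'').1 hOP (hBO'' hyB) hyO
        exact hBO (this ▸ hBO'')
      obtain ⟨O', hO', hzO'⟩ := hout B hB hBJ z hzB
      exact ⟨O, O', hO, hO', fun h => hzO (h ▸ hzO'), x, hx, hxO, B, hB, y, hyB, z, hzB, hyO, hzO'⟩
    choose! f g hf hg hfg x hxA hxf B hB y hyB z hzB hyf hzg using hex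
    -- a point of the pair of parts assigned to `A` is close to `x A`
    have hclose : ∀ A ∈ S \ J, ∀ O ∈ ({f A, g A} : Finset (Finset E)), ∀ q ∈ O,
        dist (x A) q ≤ 2 * r + s := by
      intro A hA O hO q hq
      have hrO : ∀ O ∈ V, ∀ u ∈ O, ∀ v ∈ O, dist u v ≤ r := fun O hO u hu v hv =>
        (Finset.dist_le_diam O hu hv).trans (hP O (Finset.mem_filter.1 hO).1)
      rcases Finset.mem_insert.1 hO with rfl | hO
      · linarith [hrO _ (hf A hA) _ (hxf A hA) _ hq]
      · rw [Finset.mem_singleton] at hO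
        subst hO
        have h1 := hrO _ (hf A hA) _ (hxf A hA) _ (hyf A hA)
        have h2 := (Finset.dist_le_diam _ (hyB A hA) (hzB A hA)).trans (hL.diam_le hs (hB A hA))
        have h3 := hrO _ (hg A hA) _ (hzg A hA) _ hq
        linarith [dist_triangle4 (x A) (y A) (z A) q]
    have hdisj : ((S \ J : Finset (Finset E)) : Set (Finset E)).PairwiseDisjoint
        fun A => ({f A, g A} : Finset (Finset E)) := by
      intro A hA B hB hAB
      refine Finset.disjoint_left.2 fun O hOA hOB => ?_
      have hOP : O ∈ P.parts := by
        rcases Finset.mem_insert.1 hOA with rfl | h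
        · exact (Finset.mem_filter.1 (hf A hA)).1
        · rw [Finset.mem_singleton.1 h]
          exact (Finset.mem_filter.1 (hg A hA)).1
      obtain ⟨q, hq⟩ := P.nonempty_of_mem_parts hOP
      have h1 := hclose A hA O hOA q hq
      have h2 := hclose B hB O hOB q hq
      rw [dist_comm] at h2
      -- A common part would put `x A` and `x B` within `2 * (2 * r + s)`, so the union would have
      -- diameter at most `4 * s + 4 * r = t`.
      have h3 := Finset.diam_union_le A B (hxA A hA) (hxA B hB)
      obtain ⟨hAt, hAs⟩ := Finset.mem_filter.1 (Finset.mem_sdiff.1 hA).1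
      obtain ⟨hBt, hBs⟩ := Finset.mem_filter.1 (Finset.mem_sdiff.1 hB).1
      have h4 := hL.lt_diam_union ht0 hAt hBt hAB
      linarith [dist_triangle (x A) q (x B), hL.diam_le hs hAs, hL.diam_le hs hBs]
    calc 2 * (S \ J).card = ∑ A ∈ S \ J, ({f A, g A} : Finset (Finset E)).card := by
          rw [Finset.sum_congr rfl fun A hA => Finset.card_pair (hfg A hA), Finset.sum_const,
            smul_eq_mul, mul_comm]
      _ = ((S \ J).biUnion fun A => ({f A, g A} : Finset (Finset E))).card :=
          (Finset.card_biUnion hdisj).symm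
      _ ≤ V.card := by
          refine Finset.card_le_card (Finset.biUnion_subset.2 fun A hA => ?_)
          exact Finset.insert_subset (hf A hA) (Finset.singleton_subset_iff.2 (hg A hA))
  have hSJ : S.card ≤ J.card + (S \ J).card := by
    have := Finset.card_le_card_sdiff_add_card (s := S) (t := J)
    omega
  -- Doubled, `hmain` reads `4 * |L t| ≤ 2 * |L s| + 2 * |S| ≤ (2 * |I| + 3 * |V|) + (2 * |I| +
  -- |V|)`.
  omega

variable [NormedSpace ℝ E] [FiniteDimensional ℝ E] {d : ℕ}

/-- The exponent is the number of doublings; `12` is twice the `6` of the packing count, so that the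
remaining excess is at most `|V| / 2`. -/
lemma twelve_mul_packing_le (hd1 : 1 ≤ d) :
    12 * 2 ^ ((8 * d + 5) ^ d) * (9 * d) ^ d ≤ 2 ^ (3 * (42 * d) ^ d) := by
  have h1 : 4 ≤ (42 * d) ^ d := by
    calc 4 ≤ 42 * d := by omega
      _ ≤ (42 * d) ^ d := Nat.le_self_pow (by omega) _
  have h2 : (8 * d + 5) ^ d ≤ (42 * d) ^ d := Nat.pow_le_pow_left (by omega) _
  have h3 : (9 * d) ^ d ≤ 2 ^ ((42 * d) ^ d) :=
    Nat.lt_two_pow_self.le.trans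
      (Nat.pow_le_pow_right two_pos (Nat.pow_le_pow_left (by omega) _))
  calc 12 * 2 ^ ((8 * d + 5) ^ d) * (9 * d) ^ d
      ≤ 2 ^ ((42 * d) ^ d) * 2 ^ ((42 * d) ^ d) * 2 ^ ((42 * d) ^ d) := by
        refine Nat.mul_le_mul (Nat.mul_le_mul ?_ (Nat.pow_le_pow_right two_pos h2)) h3
        exact le_trans (by norm_num) (Nat.pow_le_pow_right two_pos h1)
    _ = 2 ^ (3 * (42 * d) ^ d) := by rw [← pow_add, ← pow_add]; congr 1; ring

/-- The three stages combine here: `j` doublings lead from `r` to `s = 2 ^ j * (2 * r) - r`, and the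
last enlargement gives `4 * s + 4 * r = 8 * 2 ^ j * r`. -/
lemma IsLinkageFiltration.card_parts_le_of_finrank (hL : IsLinkageFiltration L)
    {P : Finpartition X} (hd : Module.finrank ℝ E = d) (hd1 : 1 ≤ d) (hr : 0 < r)
    (hP : ∀ O ∈ P.parts, diam (O : Set E) ≤ r) :
    (L (8 * 2 ^ (3 * (42 * d) ^ d) * r)).parts.card ≤ P.parts.card := by
  set j := 3 * (42 * d) ^ d with hj
  have h1 : (1 : ℝ) ≤ 2 ^ j := one_le_pow₀ (by norm_num)
  have hs : 0 ≤ 2 ^ j * (2 * r) - r := by nlinarith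
  rw [show 8 * 2 ^ j * r = 4 * (2 ^ j * (2 * r) - r) + 4 * r by ring]
  refine hL.card_parts_le hr.le hP hs fun V hV => ?_
  have hPV : ∀ O ∈ V, diam (O : Set E) ≤ r := fun O hO => hP O (hV hO)
  have h2 := hL.two_pow_mul_card_partsWithin_le hr.le hPV j
  have h3 := hL.card_partsWithin_le hd hd1 hr hPV
  have h4 : (12 : ℝ) * 2 ^ ((8 * d + 5) ^ d) * (9 * d) ^ d ≤ 2 ^ j := by
    exact_mod_cast twelve_mul_packing_le hd1
  have h5 := mul_le_mul_of_nonneg_right h4 (show (0 : ℝ) ≤ V.card by positivity)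
  have h6 : (0 : ℝ) ≤ V.card := by positivity
  have h7 : (2 : ℝ) ^ j * (2 * ((L (2 ^ j * (2 * r) - r)).partsWithin (V.biUnion id)).card) ≤
      2 ^ j * (3 * V.card) := by nlinarith
  have h8 := le_of_mul_le_mul_left h7 (by positivity)
  exact_mod_cast h8

end Final

/-! ### Runs of the algorithm as filtrations -/

section Run

variable {E : Type*} [NormedAddCommGroup E] [DecidableEq E] {X : Finset E}
  {C : ℕ → Finpartition X}

lemma diam_le_diamCost {P : Finpartition X} {A : Finset E} (hA : A ∈ P.parts) :
    diam (A : Set E) ≤ diamCost P :=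
  le_ciSup (f := fun A : {A : Finset E // A ∈ P.parts} => diam ((A : Finset E) : Set E))
    (Set.finite_range _).bddAbove ⟨A, hA⟩

lemma diamCost_nonneg (P : Finpartition X) : 0 ≤ diamCost P :=
  Real.iSup_nonneg fun _ => diam_nonneg

lemma diamCost_le {P : Finpartition X} {t : ℝ} (ht : 0 ≤ t)
    (h : ∀ A ∈ P.parts, diam (A : Set E) ≤ t) : diamCost P ≤ t :=
  Real.iSup_le (fun A => h A.1 A.2) ht

lemma diamCost_mono {P Q : Finpartition X} (h : P ≤ Q) : diamCost P ≤ diamCost Q := by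
  refine diamCost_le (diamCost_nonneg Q) fun A hA => ?_
  obtain ⟨B, hB, hAB⟩ := h hA
  exact (diam_mono (Finset.coe_subset.2 hAB) B.finite_toSet.isBounded).trans (diam_le_diamCost hB)

lemma diamCost_bot : diamCost (⊥ : Finpartition X) = 0 := by
  refine le_antisymm (diamCost_le le_rfl fun A hA => ?_) (diamCost_nonneg _)
  obtain ⟨a, -, rfl⟩ := Finpartition.mem_bot_iff.1 hA
  simp

lemma IsCompleteLinkageStep.le {P Q : Finpartition X} (h : IsCompleteLinkageStep P Q) :
    P ≤ Q := by
  obtain ⟨A, hA, B, hB, hAB, -, hQ⟩ := h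
  intro S hS
  rw [hQ]
  by_cases h1 : S = A
  · exact ⟨A ∪ B, Finset.mem_insert_self _ _, h1 ▸ Finset.subset_union_left⟩
  by_cases h2 : S = B
  · exact ⟨A ∪ B, Finset.mem_insert_self _ _, h2 ▸ Finset.subset_union_right⟩
  exact ⟨S, Finset.mem_insert_of_mem (Finset.mem_erase.2 ⟨h2, Finset.mem_erase.2 ⟨h1, hS⟩⟩), le_rfl⟩

lemma IsCompleteLinkageStep.card {P Q : Finpartition X} (h : IsCompleteLinkageStep P Q) :
    Q.parts.card + 1 = P.parts.card := by
  obtain ⟨A, hA, B, hB, hAB, -, hQ⟩ := h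
  have hB' : B ∈ P.parts.erase A := Finset.mem_erase.2 ⟨hAB.symm, hB⟩
  have hnot : A ∪ B ∉ (P.parts.erase A).erase B := by
    intro h
    rw [Finset.mem_erase, Finset.mem_erase] at h
    obtain ⟨a, ha⟩ := P.nonempty_of_mem_parts hA
    exact h.2.1 (P.eq_of_mem_parts h.2.2 hA (Finset.mem_union_left _ ha) ha)
  rw [hQ, Finset.card_insert_of_notMem hnot, Finset.card_erase_add_one hB',
    Finset.card_erase_add_one hA]

/-- If a merge step produces diameter cost greater than `t` although all clusters had diameter at
most `t`, then the union of any two clusters has diameter greater than `t`. -/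
lemma IsCompleteLinkageStep.lt_diam_union {P Q : Finpartition X} (h : IsCompleteLinkageStep P Q)
    {t : ℝ} (ht : 0 ≤ t) (hP : diamCost P ≤ t) (hQt : t < diamCost Q) {A' B' : Finset E}
    (hA' : A' ∈ P.parts) (hB' : B' ∈ P.parts) (hne : A' ≠ B') :
    t < diam ((A' ∪ B' : Finset E) : Set E) := by
  obtain ⟨A, hA, B, hB, hAB, hmin, hQ⟩ := h
  refine lt_of_lt_of_le ?_ (hmin A' hA' B' hB' hne)
  by_contra! hle
  refine hQt.not_ge (diamCost_le ht fun S hS => ?_)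
  rw [hQ, Finset.mem_insert] at hS
  rcases hS with rfl | hS
  · exact hle
  · exact (diam_le_diamCost (Finset.mem_of_mem_erase (Finset.mem_of_mem_erase hS))).trans hP

lemma IsCompleteLinkageRun.card_parts (hC : IsCompleteLinkageRun X C) {i : ℕ} (hi : 1 ≤ i)
    (hiX : i ≤ X.card) : (C i).parts.card = i := by
  induction hiX using Nat.decreasingInduction with
  | self => rw [hC.1, Finpartition.card_bot]
  | of_succ i hiX ih =>
    have := (hC.2 i hi hiX).card
    have := ih (by omega)
    omega

lemma IsCompleteLinkageRun.le (hC : IsCompleteLinkageRun X C) {i j : ℕ} (hi : 1 ≤ i)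
    (hij : i ≤ j) (hj : j ≤ X.card) : C j ≤ C i := by
  induction j, hij using Nat.le_induction with
  | base => exact le_rfl
  | succ j hij ih => exact (hC.2 j (hi.trans hij) hj).le.trans (ih (by omega))

/-- The last clusterings of a run with diameter cost at most `t` form a linkage filtration. -/
lemma IsCompleteLinkageRun.exists_filtration (hC : IsCompleteLinkageRun X C) (hX : 1 ≤ X.card) :
    ∃ i : ℝ → ℕ, (∀ t, 0 ≤ t → 1 ≤ i t ∧ i t ≤ X.card) ∧
      IsLinkageFiltration fun t => C (i t) := by
  have hex : ∀ t : ℝ, 0 ≤ t → ∃ i, (1 ≤ i ∧ i ≤ X.card ∧ diamCost (C i) ≤ t) ∧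
      ∀ j, 1 ≤ j → j < i → t < diamCost (C j) := by
    classical
    intro t ht
    have h : ∃ i, 1 ≤ i ∧ i ≤ X.card ∧ diamCost (C i) ≤ t :=
      ⟨X.card, hX, le_rfl, by rw [hC.1, diamCost_bot]; exact ht⟩
    refine ⟨Nat.find h, Nat.find_spec h, fun j hj hji => ?_⟩
    by_contra! hle
    exact Nat.find_min h hji ⟨hj, hji.le.trans (Nat.find_spec h).2.1, hle⟩
  choose! i hi hmin using hex
  refine ⟨i, fun t ht => ⟨(hi t ht).1, (hi t ht).2.1⟩, ?_, ?_, ?_⟩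
  · exact fun {t} ht {A} hA => (diam_le_diamCost hA).trans (hi t ht).2.2
  · intro t ht A B hA hB hAB
    obtain ⟨h1, h2, h3⟩ := hi t ht
    obtain ⟨j, hj⟩ : ∃ j, i t = j + 1 := ⟨i t - 1, by omega⟩
    -- If `i t = 1` there is only one cluster and nothing to separate; otherwise the next merge
    -- exceeds `t` by minimality of `i t`.
    rcases Nat.eq_zero_or_pos j with rfl | hj1
    · have := hC.card_parts h1 h2
      rw [hj, zero_add] at this
      exact absurd (Finset.card_le_one.1 this.le A (by simpa [hj] using hA) B
        (by simpa [hj] using hB)) hAB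
    · have hstep := hC.2 j hj1 (by omega)
      rw [← hj] at hstep
      exact hstep.lt_diam_union ht h3 (hmin t ht j hj1 (by omega)) hA hB hAB
  · intro s t hs hst
    refine hC.le (hi t (hs.trans hst)).1 ?_ (hi s hs).2.1
    by_contra! hlt
    have := hmin t (hs.trans hst) (i s) (hi s hs).1 hlt
    linarith [(hi s hs).2.2]

variable [NormedSpace ℝ E] [FiniteDimensional ℝ E] {d : ℕ}

/-- Complete linkage is a constant factor approximation in every fixed dimension. -/
lemma IsCompleteLinkageRun.diamCost_le (hC : IsCompleteLinkageRun X C)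
    (hd : Module.finrank ℝ E = d) {k : ℕ} (hk : 1 ≤ k) (hkX : k ≤ X.card) :
    diamCost (C k) ≤ 8 * 2 ^ (3 * (42 * d) ^ d) * optDiamCost X k := by
  have hM : (0 : ℝ) < 8 * 2 ^ (3 * (42 * d) ^ d) := by positivity
  rw [← div_le_iff₀' hM]
  refine le_csInf ⟨_, C k, hC.card_parts hk hkX, rfl⟩ ?_
  rintro _ ⟨P, hPk, rfl⟩
  rw [div_le_iff₀' hM]
  -- The scale factor `1 + 1 / (2 * d)` needs `d ≥ 1`; in dimension zero all diameters vanish.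
  rcases Nat.eq_zero_or_pos d with rfl | hd1
  · have := Module.finrank_zero_iff.1 hd
    refine le_trans (_root_.diamCost_le le_rfl fun A _ => ?_)
      (mul_nonneg hM.le (diamCost_nonneg P))
    rw [diam_subsingleton Set.subsingleton_of_subsingleton]
  · obtain ⟨i, hi, hL⟩ := hC.exists_filtration (hk.trans hkX)
    -- The scales `r / b ^ i` require `r > 0`, whereas the cost of `P` may be zero.
    refine le_of_forall_pos_le_add fun ε hε => ?_
    set r := diamCost P + ε / (8 * 2 ^ (3 * (42 * d) ^ d)) with hr
    have hr0 : 0 < r := add_pos_of_nonneg_of_pos (diamCost_nonneg P) (by positivity)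
    have hcard := hL.card_parts_le_of_finrank (P := P) hd hd1 hr0 fun O hO =>
      (diam_le_diamCost hO).trans (by
        rw [hr]
        linarith [show 0 < ε / (8 * 2 ^ (3 * (42 * d) ^ d)) by positivity])
    have ht : 0 ≤ 8 * 2 ^ (3 * (42 * d) ^ d) * r := by positivity
    obtain ⟨h1, h2⟩ := hi _ ht
    rw [hPk, hC.card_parts h1 h2] at hcard
    calc diamCost (C k) ≤ diamCost (C (i (8 * 2 ^ (3 * (42 * d) ^ d) * r))) :=
          diamCost_mono (hC.le h1 hcard hkX)
      _ ≤ 8 * 2 ^ (3 * (42 * d) ^ d) * r := _root_.diamCost_le ht fun A hA => hL.diam_le ht hA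
      _ = 8 * 2 ^ (3 * (42 * d) ^ d) * diamCost P + ε := by rw [hr]; field_simp

end Run

/-! ### Growth of the constant and conclusion -/

lemma isAtMostDoublyExponential_const_mul :
    IsAtMostDoublyExponential fun d => 8 * 2 ^ (3 * (42 * d) ^ d) := by
  refine ⟨10, fun d hd => ?_⟩
  have hd0 : (1 : ℝ) ≤ d := mod_cast hd
  have h1 : (2 : ℝ) ^ (10 * (d : ℝ) * Real.logb 2 ((d : ℝ) + 1)) = ((d : ℝ) + 1) ^ (10 * d) := by
    rw [mul_comm, Real.rpow_mul two_pos.le, Real.rpow_logb two_pos (by norm_num) (by linarith)]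
    exact_mod_cast Real.rpow_natCast ((d : ℝ) + 1) (10 * d)
  -- The exponent `10` comes from `6 * 42 * d ≤ 2 ^ 9 * (d + 1) ≤ (d + 1) ^ 10`.
  have h2 : 3 + 3 * (42 * d) ^ d ≤ (d + 1) ^ (10 * d) := by
    have h3 : 1 ≤ (42 * d) ^ d := Nat.one_le_pow _ _ (by omega)
    have h4 : 6 ≤ 6 ^ d := Nat.le_self_pow (by omega) _
    have h5 : 6 * (42 * d) ≤ (d + 1) ^ 10 := by
      calc 6 * (42 * d) ≤ (1 + 1) ^ 9 * (d + 1) := by omega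
        _ ≤ (d + 1) ^ 9 * (d + 1) := by gcongr
        _ = (d + 1) ^ 10 := by ring
    calc 3 + 3 * (42 * d) ^ d ≤ 6 * (42 * d) ^ d := by omega
      _ ≤ 6 ^ d * (42 * d) ^ d := Nat.mul_le_mul_right _ h4
      _ = (6 * (42 * d)) ^ d := (mul_pow _ _ _).symm
      _ ≤ ((d + 1) ^ 10) ^ d := Nat.pow_le_pow_left h5 _
      _ = (d + 1) ^ (10 * d) := (pow_mul _ _ _).symm
  rw [h1]
  calc (8 : ℝ) * 2 ^ (3 * (42 * d) ^ d) = 2 ^ (3 + 3 * (42 * d) ^ d) := by rw [pow_add]; norm_num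
    _ = (2 : ℝ) ^ (((3 + 3 * (42 * d) ^ d : ℕ)) : ℝ) := (Real.rpow_natCast _ _).symm
    _ ≤ _ := Real.rpow_le_rpow_of_exponent_le (by norm_num) (mod_cast h2)

lemma optDiamCost_nonneg {E : Type*} [NormedAddCommGroup E] [DecidableEq E] (X : Finset E)
    (k : ℕ) : 0 ≤ optDiamCost X k :=
  Real.sInf_nonneg (by rintro _ ⟨P, -, rfl⟩; exact diamCost_nonneg P)

/-- `E` ranges over all real normed spaces of dimension `d`, i.e. `ℝ^d` with an arbitrary norm. -/
theorem mainTheorem1 :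
    ∃ c : ℕ → ℝ, IsAtMostDoublyExponential c ∧
      ∀ (d : ℕ) (E : Type*) [NormedAddCommGroup E] [NormedSpace ℝ E] [FiniteDimensional ℝ E]
        [DecidableEq E], Module.finrank ℝ E = d →
        ∀ (X : Finset E) (C : ℕ → Finpartition X), IsCompleteLinkageRun X C →
          ∀ k : ℕ, 1 ≤ k → k ≤ X.card →
            diamCost (C k) ≤
              2 * (Real.logb 2 (k : ℝ) + 2) *
                ((2 : ℝ) ^ (3 * (42 * d) ^ d) * (28 * (d : ℝ) + 6) + 2) * optDiamCost X k ∧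
            (2 ≤ k → diamCost (C k) ≤ c d * Real.logb 2 (k : ℝ) * optDiamCost X k) := by
  refine ⟨_, isAtMostDoublyExponential_const_mul, ?_⟩
  intro d E _ _ _ _ hd X C hC k hk hkX
  have h := hC.diamCost_le hd hk hkX
  have hopt := optDiamCost_nonneg X k
  have hM : (0 : ℝ) < 2 ^ (3 * (42 * d) ^ d) := by positivity
  refine ⟨h.trans (mul_le_mul_of_nonneg_right ?_ hopt), fun hk2 =>
    h.trans (mul_le_mul_of_nonneg_right ?_ hopt)⟩
  · have hlog : 0 ≤ Real.logb 2 (k : ℝ) := Real.logb_nonneg (by norm_num) (mod_cast hk)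
    -- Since `logb 2 k ≥ 0`, the prefactor is at least `4`, so twice `2 ^ (3 * (42 * d) ^ d)` in the
    -- other factor suffices.
    have h1 : (2 : ℝ) ^ (3 * (42 * d) ^ d) * 2 ≤
        2 ^ (3 * (42 * d) ^ d) * (28 * (d : ℝ) + 6) + 2 := by
      nlinarith [mul_nonneg hM.le (Nat.cast_nonneg (α := ℝ) d)]
    nlinarith [mul_nonneg hlog (show (0 : ℝ) ≤ 2 ^ (3 * (42 * d) ^ d) * (28 * (d : ℝ) + 6) + 2 by
      positivity)]
  · have hlog : 1 ≤ Real.logb 2 (k : ℝ) := by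
      rw [Real.le_logb_iff_rpow_le (by norm_num) (by positivity), Real.rpow_one]
      exact_mod_cast hk2
    exact le_mul_of_one_le_right (by positivity) hlog
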